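/- A monoid $P$ is right-LCM if it is left cancellative and, for all $p,q\in P$, either $pP\cap qP=\emptyset$ or $pP\cap qP=rP$ for some $r\in P$; the set of all such $r$ is denoted $p\vee q$ (it is empty if $pP\cap qP=\emptyset$). A monoid homomorphism $V$ from a right-LCM monoid $P$ to the isometries on a Hilbert space is Nica-covariant if, for all $x,y\in P$, $$V_xV_x^*V_yV_y^*=\begin{cases}V_rV_r^* & \text{if } r\in x\vee y,\\ 0 & \text{if } x\vee y=\emptyset.\end{cases}$$ Let $C^*(P)$ be the universal $C^*$-algebra generated by a Nica-covariant representation $V^u$ of $P$, and let $C^*_\lambda(P)\subseteq\mathcal B(\ell^2(P))$ be the $C^*$-algebra generated by the operators $\lambda(p)\colon\delta_q\mapsto\delta_{pq}$, $p\in P$. The right-LCM monoid $P$ is Nica amenable if the canonical surjective $*$-homomorphism $\lambda\colon C^*(P)\to C^*_\lambda(P)$, $V^u_p\mapsto\lambda(p)$, is an isomorphism. Theorem. Let $P$ be a (left and right) cancellative right-LCM monoid, and let $P_1\subseteq P$ be a submonoid such that (a) $P_1$ is closed under factorization: if $x,y\in P$ and $xy\in P_1$, then $x,y\in P_1$; and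 (b) the inclusion preserves orthogonality: for all $x,y\in P_1$, $xP_1\cap yP_1=\emptyset$ if and only if $xP\cap yP=\emptyset$. If $P$ is Nica amenable, then $P_1$ is a right-LCM monoid and $P_1$ is Nica amenable. -/

import Mathlib

open scoped ENNReal

universe u

noncomputable section

/-! ### Right-LCM monoids and submonoids -/

/-- The principal right ideal `pP`. -/
def rightIdeal {P : Type*} [Monoid P] (p : P) : Set P :=
  Set.range fun x : P => p * x

/-- `p ∨ q`: the set of all least common multiples of `p` and `q`, that is,
of all `r` with `pP ∩ qP = rP`. -/
def lcmSet {P : Type*} [Monoid P] (p q : P) : Set P :=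
  {r | rightIdeal p ∩ rightIdeal q = rightIdeal r}

/-- A right-LCM monoid: a left cancellative monoid such that for all `p`, `q` either `pP ∩ qP` is
empty or it is a principal right ideal. -/
class IsRightLCM (P : Type*) [Monoid P] : Prop extends IsLeftCancelMul P where
  clifford : ∀ p q : P, rightIdeal p ∩ rightIdeal q = ∅ ∨
    ∃ r : P, rightIdeal p ∩ rightIdeal q = rightIdeal r

/-- `P₁` is closed under factorization in `P`. -/
def ClosedUnderFactorization {P : Type*} [Monoid P] (P₁ : Submonoid P) : Prop :=
  ∀ x y : P, x * y ∈ P₁ → x ∈ P₁ ∧ y ∈ P₁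

/-- The inclusion `P₁ ⊆ P` preserves orthogonality: for `x, y ∈ P₁`, `xP₁ ∩ yP₁ = ∅` if and only
if `xP ∩ yP = ∅`. -/
def PreservesOrthogonality {P : Type*} [Monoid P] (P₁ : Submonoid P) : Prop :=
  ∀ x y : P₁, rightIdeal x ∩ rightIdeal y = ∅ ↔ rightIdeal (x : P) ∩ rightIdeal (y : P) = ∅

/-! ### Nica covariant isometric representations -/

/-- A Nica covariant isometric representation of `P` in a unital star ring (such as `B(H)`, where
`star` is the adjoint, so that `star (V p) * V p = 1` says that `V p` is an isometry). -/
structure IsNicaCovariant {P : Type*} [Monoid P] {A : Type*} [Ring A] [StarRing A]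
    (V : P →* A) : Prop where
  isometric : ∀ p, star (V p) * V p = 1
  covariant : ∀ x y r, r ∈ lcmSet x y →
    V x * star (V x) * (V y * star (V y)) = V r * star (V r)
  orthogonal : ∀ x y, lcmSet x y = ∅ →
    V x * star (V x) * (V y * star (V y)) = 0

/-- A Nica covariant isometric representation of `P` on a nonzero complex Hilbert space. The Hilbert
spaces are taken in the universe of `P`, which loses nothing: every Nica covariant representation is
a direct sum of cyclic ones, and a cyclic one lives on a Hilbert space with a dense subset of
cardinality at most `max |P| ℵ₀`. -/
structure NicaRep (P : Type u) [Monoid P] where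
  H : Type u
  [normed : NormedAddCommGroup H]
  [inner : InnerProductSpace ℂ H]
  [complete : CompleteSpace H]
  [nontrivial : Nontrivial H]
  V : P →* (H →L[ℂ] H)
  nica : IsNicaCovariant V

attribute [instance] NicaRep.normed NicaRep.inner NicaRep.complete NicaRep.nontrivial

/-! ### The full C⋆-algebra -/

section Full

variable (P : Type u) [Monoid P]

/-- The C⋆-algebra of bounded families of operators, one for each Nica covariant representation. -/
abbrev BoundedFamilies : Type (u + 1) :=
  lp (fun π : NicaRep P => π.H →L[ℂ] π.H) ∞

variable {P}

theorem NicaRep.norm_le_one (π : NicaRep P) (p : P) : ‖π.V p‖ ≤ 1 := by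
  have h := CStarRing.norm_star_mul_self (x := π.V p)
  rw [π.nica.isometric p, norm_one] at h
  nlinarith [norm_nonneg (π.V p)]

variable (P)

/-- The universal Nica covariant representation: `p ↦ (π(p))_π`, with `π` running through all Nica
covariant representations. -/
def universalRep : P →* BoundedFamilies P where
  toFun p := ⟨fun π => π.V p, memℓp_infty ⟨1, by
    rintro _ ⟨π, rfl⟩
    exact π.norm_le_one p⟩⟩
  map_one' := by
    ext1
    funext π
    exact map_one π.V
  map_mul' p q := by
    ext1
    funext π
    exact map_mul π.V p q

theorem universalRep_apply (p : P) (π : NicaRep P) : universalRep P p π = π.V p := rfl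

/-- The full semigroup C⋆-algebra `C*(P)`: the C⋆-algebra generated by the universal Nica covariant
representation. -/
def fullCStar : StarSubalgebra ℂ (BoundedFamilies P) :=
  (StarAlgebra.adjoin ℂ (Set.range (universalRep P))).topologicalClosure

/-- Evaluation of a bounded family at one representation. -/
def evalRep (π : NicaRep P) : BoundedFamilies P →⋆ₐ[ℂ] (π.H →L[ℂ] π.H) where
  toFun f := f π
  map_one' := rfl
  map_mul' _ _ := rfl
  map_zero' := rfl
  map_add' _ _ := rfl
  commutes' _ := rfl
  map_star' _ := rfl

theorem continuous_evalRep (π : NicaRep P) : Continuous (evalRep P π) :=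
  (lp.evalCLM ℂ (fun π : NicaRep P => π.H →L[ℂ] π.H) ∞ π).continuous

variable {P}

/-- The C⋆-algebra of operators generated by the operators `V p`. -/
def NicaRep.cstar (π : NicaRep P) : StarSubalgebra ℂ (π.H →L[ℂ] π.H) :=
  (StarAlgebra.adjoin ℂ (Set.range π.V)).topologicalClosure

theorem evalRep_mem (π : NicaRep P) (a : fullCStar P) : evalRep P π a ∈ π.cstar := by
  have h : (StarAlgebra.adjoin ℂ (Set.range (universalRep P))).map (evalRep P π) =
      StarAlgebra.adjoin ℂ (Set.range π.V) := by
    rw [StarAlgHom.map_adjoin, ← Set.range_comp]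
    rfl
  have h' := StarSubalgebra.map_topologicalClosure_le
    (StarAlgebra.adjoin ℂ (Set.range (universalRep P))) (evalRep P π) (continuous_evalRep P π)
  rw [h] at h'
  exact h' ⟨a, a.2, rfl⟩

/-- The canonical ⋆-homomorphism of `C*(P)` onto the C⋆-algebra generated by a Nica covariant
representation `V`; it sends `universalRep P p` to `V p`. -/
def NicaRep.hom (π : NicaRep P) : fullCStar P →⋆ₐ[ℂ] π.cstar :=
  ((evalRep P π).comp (fullCStar P).subtype).codRestrict π.cstar (evalRep_mem π)

theorem universalRep_mem (p : P) : universalRep P p ∈ fullCStar P :=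
  StarSubalgebra.le_topologicalClosure _ (StarAlgebra.subset_adjoin ℂ _ ⟨p, rfl⟩)

theorem NicaRep.hom_universalRep (π : NicaRep P) (p : P) :
    (π.hom ⟨universalRep P p, universalRep_mem p⟩ : π.H →L[ℂ] π.H) = π.V p := rfl

variable (P) in
theorem universalRep_isNicaCovariant : IsNicaCovariant (universalRep P) where
  isometric p := lp.ext (funext fun π => π.nica.isometric p)
  covariant x y r h := lp.ext (funext fun π => π.nica.covariant x y r h)
  orthogonal x y h := lp.ext (funext fun π => π.nica.orthogonal x y h)

end Full

/-! ### The left regular representation -/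

section Regular

/-- The Hilbert space `ℓ²(P)`. -/
abbrev ell2 (P : Type*) : Type _ := lp (fun _ : P => ℂ) 2

/-- The standard orthonormal basis `δ` of `ℓ²(P)`. -/
def stdBasis (P : Type*) : HilbertBasis P ℂ (ell2 P) :=
  ⟨LinearIsometryEquiv.refl ℂ (ell2 P)⟩

variable (P : Type u) [Monoid P] [IsLeftCancelMul P]

theorem orthogonalFamily_mul (p : P) :
    OrthogonalFamily ℂ (fun _ : P => ℂ) fun q =>
      LinearIsometry.toSpanSingleton ℂ (ell2 P) ((stdBasis P).orthonormal.1 (p * q)) :=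
  ((stdBasis P).orthonormal.comp (fun q => p * q) (mul_right_injective p)).orthogonalFamily

/-- The isometry `λ(p)` of `ℓ²(P)`, determined by `λ(p) δ_q = δ_{pq}`: it sends `f` to
`∑ q, f q • δ_{pq}`. -/
def regularOp (p : P) : ell2 P →ₗᵢ[ℂ] ell2 P :=
  (orthogonalFamily_mul P p).linearIsometry

theorem regularOp_basis (p q : P) : regularOp P p (stdBasis P q) = stdBasis P (p * q) := by
  classical
  have h : stdBasis P q = lp.single 2 q (1 : ℂ) := (stdBasis P).repr_self q
  rw [h]
  refine ((orthogonalFamily_mul P p).linearIsometry_apply_single (1 : ℂ)).trans ?_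
  simp

theorem mul_clm_apply {H : Type*} [NormedAddCommGroup H] [InnerProductSpace ℂ H]
    (S T : H →L[ℂ] H) (f : H) : (S * T) f = S (T f) := rfl

theorem ext_stdBasis {P : Type*} {S T : ell2 P →L[ℂ] ell2 P}
    (h : ∀ q, S (stdBasis P q) = T (stdBasis P q)) : S = T := by
  refine ContinuousLinearMap.ext_on
    (Submodule.dense_iff_topologicalClosure_eq_top.mpr (stdBasis P).dense_span) ?_
  rintro _ ⟨q, rfl⟩
  exact h q

/-- The left regular representation `p ↦ λ(p)` on `ℓ²(P)`. -/
def regularMonoidHom : P →* (ell2 P →L[ℂ] ell2 P) where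
  toFun p := (regularOp P p).toContinuousLinearMap
  map_one' := ext_stdBasis fun q => by simp [regularOp_basis]
  map_mul' p q := ext_stdBasis fun r => by simp [regularOp_basis, mul_assoc]

theorem regular_basis (p q : P) :
    regularMonoidHom P p (stdBasis P q) = stdBasis P (p * q) := regularOp_basis P p q

theorem regular_isometric (p : P) : star (regularMonoidHom P p) * regularMonoidHom P p = 1 :=
  (ContinuousLinearMap.isometry_iff_adjoint_comp_self _).mp (regularOp P p).isometry

/-- `λ(p)* δ_q = 0` for `q ∉ pP`. -/
theorem star_regular_of_notMem {p q : P} (h : q ∉ rightIdeal p) :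
    star (regularMonoidHom P p) (stdBasis P q) = 0 := by
  rw [ContinuousLinearMap.star_eq_adjoint]
  refine (stdBasis P).repr.injective (lp.ext (funext fun x => ?_))
  rw [HilbertBasis.repr_apply_apply, ContinuousLinearMap.adjoint_inner_right, regular_basis,
    (stdBasis P).orthonormal.2 (fun e => h ⟨x, e⟩)]
  simp

open scoped Classical in
/-- `λ(p) λ(p)*` is the multiplication by the characteristic function of `pP`. -/
theorem regular_range_proj (p q : P) :
    (regularMonoidHom P p * star (regularMonoidHom P p)) (stdBasis P q) =
      if q ∈ rightIdeal p then stdBasis P q else 0 := by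
  split_ifs with h
  · obtain ⟨x, rfl⟩ := h
    have h1 := DFunLike.congr_fun (regular_isometric P p) (stdBasis P x)
    rw [mul_clm_apply, regular_basis] at h1
    rw [mul_clm_apply, h1]
    exact regular_basis P p x
  · rw [mul_clm_apply, star_regular_of_notMem P h, map_zero]

theorem regular_isNicaCovariant (P : Type u) [Monoid P] [IsRightLCM P] :
    IsNicaCovariant (regularMonoidHom P) where
  isometric := regular_isometric P
  covariant x y r h := ext_stdBasis fun q => by
    classical
    have h' : q ∈ rightIdeal r ↔ q ∈ rightIdeal x ∧ q ∈ rightIdeal y := by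
      rw [← Set.mem_inter_iff, show rightIdeal x ∩ rightIdeal y = rightIdeal r from h]
    rw [mul_clm_apply, regular_range_proj, regular_range_proj]
    by_cases hy : q ∈ rightIdeal y
    · rw [if_pos hy, regular_range_proj]
      simp [h', hy]
    · simp [h', hy]
  orthogonal x y h := ext_stdBasis fun q => by
    classical
    have h' : ¬ (q ∈ rightIdeal x ∧ q ∈ rightIdeal y) := by
      intro hq
      rcases IsRightLCM.clifford x y with h0 | ⟨r, hr⟩
      · exact Set.notMem_empty q (h0 ▸ hq)
      · exact Set.notMem_empty r (h ▸ (show r ∈ lcmSet x y from hr))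
    rw [mul_clm_apply, regular_range_proj]
    by_cases hy : q ∈ rightIdeal y
    · rw [if_pos hy, regular_range_proj, if_neg fun hx => h' ⟨hx, hy⟩]
      rfl
    · simp [hy]

/-- The left regular representation of a right-LCM monoid as a Nica covariant representation. -/
def regularRep (P : Type u) [Monoid P] [IsRightLCM P] : NicaRep P where
  H := ell2 P
  nontrivial := ⟨stdBasis P 1, 0, (stdBasis P).orthonormal.ne_zero 1⟩
  V := regularMonoidHom P
  nica := regular_isNicaCovariant P

end Regular

/-- A right-LCM monoid `P` is Nica amenable if the left regular representation
`C*(P) → C*_λ(P)`, where `C*_λ(P) ⊆ B(ℓ²(P))` is the C⋆-algebra generated by the operators `λ(p)`,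
is an isomorphism. -/
def NicaAmenable (P : Type u) [Monoid P] [IsRightLCM P] : Prop :=
  Function.Bijective (regularRep P).hom

end

/-! ### Principal right ideals -/

section RightIdeals

variable {P : Type*} [Monoid P]

/-! Let `a` in `C*(P₁)` be killed by the regular representation of `P₁`. Injectivity requires `σ(a)
= 0` for every Nica covariant `σ` of `P₁`; surjectivity then follows, as an injective ⋆-homomorphism
of C⋆-algebras has closed range. Two transfers between `P₁` and `P` do the work.

Regular representations: `λ_P` restricted to `P₁` also kills `a`
(`evalRep_restrict_regularRep_eq_zero`). By right cancellation the vector state of `δ_x` vanishes on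
`V_p V_q*` unless `p = q`, and then only tests whether `x ∈ qP`. On finitely many such products it
agrees with the state of `δ_z` for a suitable left factor `z ∈ P₁` of `x` (`exists_vectorState_eq`).
Hence `λ_P` kills the image of `a` in `C*(P)`, this image is `0` by amenability of `P`, and every
restriction to `P₁` of a Nica covariant representation of `P` kills `a`.

Dilation: every `σ` sits inside such a restriction (`IsNicaPartial.exists_dilation`). Closure under
factorization makes the extension of `σ` by zero a homomorphism `U` on `P`, and together with (b)
makes it Nica covariant. Put `K(q, q') = U_c U_{c'}*` if `qP ∩ q'P = qcP` with `qc = q'c'`, and `0`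
if the ideals are disjoint. This kernel is left invariant and positive, so the translations of its
reproducing kernel Hilbert space represent `P`, and `v ↦ K_1 v` embeds `σ`. The hard point is
positivity (`re_sum_inner_diffKernel_nonneg`): finitely many ideals `qP` cut `P` into atoms, and on
each atom the kernel has the form `β_{q'} Q β_q*` with `Q` a projection. -/

theorem mem_rightIdeal_self (p : P) : p ∈ rightIdeal p := ⟨1, mul_one p⟩

theorem rightIdeal_one : rightIdeal (1 : P) = Set.univ :=
  Set.eq_univ_of_forall fun x => ⟨x, one_mul x⟩

theorem rightIdeal_mul (p q : P) : rightIdeal (p * q) = (p * ·) '' rightIdeal q := by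
  ext x
  simp [rightIdeal, mul_assoc]

theorem rightIdeal_mul_subset (p q : P) : rightIdeal (p * q) ⊆ rightIdeal p := by
  rintro _ ⟨x, rfl⟩
  exact ⟨q * x, (mul_assoc p q x).symm⟩

theorem rightIdeal_subset_iff {p q : P} : rightIdeal p ⊆ rightIdeal q ↔ p ∈ rightIdeal q := by
  refine ⟨fun h => h (mem_rightIdeal_self p), ?_⟩
  rintro ⟨x, rfl⟩
  exact rightIdeal_mul_subset q x

theorem rightIdeal_mul_inter [IsLeftCancelMul P] (p q r : P) :
    rightIdeal (p * q) ∩ rightIdeal (p * r) = (p * ·) '' (rightIdeal q ∩ rightIdeal r) := by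
  rw [rightIdeal_mul, rightIdeal_mul, Set.image_inter (mul_right_injective p)]

theorem rightIdeal_ne_empty (p : P) : rightIdeal p ≠ ∅ :=
  Set.Nonempty.ne_empty ⟨p, mem_rightIdeal_self p⟩

theorem lcmSet_eq_empty_iff [IsRightLCM P] {p q : P} :
    lcmSet p q = ∅ ↔ rightIdeal p ∩ rightIdeal q = ∅ := by
  refine ⟨fun h => ?_, fun h => ?_⟩
  · rcases IsRightLCM.clifford p q with h0 | ⟨r, hr⟩
    · exact h0
    · exact absurd h (Set.Nonempty.ne_empty ⟨r, hr⟩)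
  · refine Set.eq_empty_of_forall_notMem fun r hr => rightIdeal_ne_empty r ?_
    rw [← h]
    exact (show rightIdeal p ∩ rightIdeal q = rightIdeal r from hr).symm

theorem exists_lcm [IsRightLCM P] {p q x : P} (hp : x ∈ rightIdeal p) (hq : x ∈ rightIdeal q) :
    ∃ r, r ∈ lcmSet p q := by
  by_contra! h
  exact Set.notMem_empty x (lcmSet_eq_empty_iff.mp (Set.eq_empty_of_forall_notMem h) ▸ ⟨hp, hq⟩)

/-- The empty set and the principal right ideals. -/
def IsConstructible (S : Set P) : Prop := S = ∅ ∨ ∃ s, S = rightIdeal s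

theorem isConstructible_rightIdeal (s : P) : IsConstructible (rightIdeal s) := .inr ⟨s, rfl⟩

theorem IsConstructible.inter [IsRightLCM P] {S T : Set P} (hS : IsConstructible S)
    (hT : IsConstructible T) : IsConstructible (S ∩ T) := by
  rcases hS with rfl | ⟨s, rfl⟩
  · exact .inl (Set.empty_inter T)
  rcases hT with rfl | ⟨t, rfl⟩
  · exact .inl (Set.inter_empty _)
  exact IsRightLCM.clifford s t

end RightIdeals

/-! ### Nica covariant families of isometries and zeros -/

/-- A multiplicative family, each of whose members is `0` or an isometry, that satisfies the Nica
covariance relations. -/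
structure IsNicaPartial {P : Type*} [Monoid P] {A : Type*} [Ring A] [StarRing A]
    (U : P →* A) : Prop where
  zero_or_isometric : ∀ p, U p = 0 ∨ star (U p) * U p = 1
  covariant : ∀ x y r, r ∈ lcmSet x y →
    U x * star (U x) * (U y * star (U y)) = U r * star (U r)
  orthogonal : ∀ x y, lcmSet x y = ∅ →
    U x * star (U x) * (U y * star (U y)) = 0

namespace IsNicaPartial

variable {P : Type*} [Monoid P] {A : Type*} [Ring A] [StarRing A] {U : P →* A}

theorem mul_star_mul_self (hU : IsNicaPartial U) (x : P) : U x * star (U x) * U x = U x := by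
  rcases hU.zero_or_isometric x with h | h
  · simp [h]
  · rw [mul_assoc, h, mul_one]

/-- Here `uP = P`, so covariance for `u` and `1` applies with `r = 1`. This is what makes the kernel
below independent of the chosen generator. -/
theorem unit_mul_star (hU : IsNicaPartial U) {u v : P} (h : u * v = 1) :
    U u * star (U u) = 1 := by
  have h' : (1 : P) ∈ lcmSet u 1 := by
    have hu : rightIdeal u = Set.univ :=
      Set.eq_univ_of_forall fun x => ⟨v * x, by simp [← mul_assoc, h]⟩
    change rightIdeal u ∩ rightIdeal 1 = rightIdeal 1
    rw [hu, Set.univ_inter]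
  simpa using hU.covariant u 1 1 h'

theorem mul_star_unit (hU : IsNicaPartial U) (c c' : P) {u v : P} (h : u * v = 1) :
    U (c * u) * star (U (c' * u)) = U c * star (U c') := by
  rw [map_mul, map_mul, star_mul, mul_assoc, ← mul_assoc (U u), hU.unit_mul_star h, one_mul]

/-- Inserting the range projection of `U d` brings covariance into play; the isometry `U d` then
cancels, and if `U d = 0` both sides vanish. -/
theorem mul_lcm (hU : IsNicaPartial U) {c d d' a b : P} (e : c * a = d * b)
    (h : c * a ∈ lcmSet c d) :
    U c * star (U c) * (U d * star (U d')) = U (c * a) * star (U (d' * b)) := by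
  have h1 : U c * star (U c) * (U d * star (U d')) =
      U c * star (U c) * (U d * star (U d)) * (U d * star (U d')) := by
    conv_lhs => rw [← hU.mul_star_mul_self d]
    simp only [mul_assoc]
  rw [h1, hU.covariant c d _ h]
  rcases hU.zero_or_isometric d with h0 | h0
  · simp [e, h0]
  · have : U (c * a) = U d * U b := by rw [e, map_mul]
    rw [this, map_mul, star_mul, star_mul]
    simp only [mul_assoc]
    rw [← mul_assoc (star (U d)) (U d), h0, one_mul]

theorem mul_disjoint (hU : IsNicaPartial U) {c d : P} (d' : P) (h : lcmSet c d = ∅) :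
    U c * star (U c) * (U d * star (U d')) = 0 := by
  have h1 : U c * star (U c) * (U d * star (U d')) =
      U c * star (U c) * (U d * star (U d)) * (U d * star (U d')) := by
    conv_lhs => rw [← hU.mul_star_mul_self d]
    simp only [mul_assoc]
  rw [h1, hU.orthogonal c d h, zero_mul]

end IsNicaPartial

/-! ### The kernels of a Nica covariant family -/

section Kernel

variable {P : Type*} [Monoid P] {A : Type*} [Ring A] [StarRing A]

open scoped Classical in
/-- The kernel `(q, q') ↦ U c * star (U c')` if `qP ∩ q'P ∩ S = qcP` and `qc = q'c'`, and `0` if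
there are no such `c` and `c'`. -/
noncomputable def lcmKernel (U : P →* A) (S : Set P) (q q' : P) : A :=
  if h : ∃ c : P × P, q * c.1 = q' * c.2 ∧ rightIdeal q ∩ rightIdeal q' ∩ S = rightIdeal (q * c.1)
  then U h.choose.1 * star (U h.choose.2) else 0

variable {U : P →* A} {S T : Set P} {q q' : P}

theorem lcmKernel_of_empty (h : rightIdeal q ∩ rightIdeal q' ∩ S = ∅) :
    lcmKernel U S q q' = 0 := by
  refine dif_neg ?_
  rintro ⟨c, -, hc⟩
  exact rightIdeal_ne_empty _ (hc.symm.trans h)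

theorem lcmKernel_congr (h : rightIdeal q ∩ rightIdeal q' ∩ S = rightIdeal q ∩ rightIdeal q' ∩ T) :
    lcmKernel U S q q' = lcmKernel U T q q' := by
  unfold lcmKernel
  generalize rightIdeal q ∩ rightIdeal q' ∩ S = I at h
  subst h
  rfl

/-- The kernel of the complement in `S` of the right ideals generated by the members of a list. -/
noncomputable def diffKernel (U : P →* A) : List P → Set P → P → P → A
  | [], S, q, q' => lcmKernel U S q q'
  | p :: L, S, q, q' => diffKernel U L S q q' - diffKernel U L (S ∩ rightIdeal p) q q'

theorem diffKernel_congr (L : List P)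
    (h : rightIdeal q ∩ rightIdeal q' ∩ S = rightIdeal q ∩ rightIdeal q' ∩ T) :
    diffKernel U L S q q' = diffKernel U L T q q' := by
  induction L generalizing S T with
  | nil => exact lcmKernel_congr h
  | cons p L ih =>
    rw [diffKernel, diffKernel, ih h, ih (S := S ∩ rightIdeal p) (T := T ∩ rightIdeal p)
      (by rw [← Set.inter_assoc, h, Set.inter_assoc])]

/-- The kernel at `(q, q')` sees only `qP ∩ q'P ∩ S`, so removing `qP` or `q'P` leaves nothing. -/
theorem diffKernel_of_mem {L : List P} (h : q ∈ L ∨ q' ∈ L) : diffKernel U L S q q' = 0 := by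
  induction L generalizing S with
  | nil => simp at h
  | cons p L ih =>
    by_cases hp : q = p ∨ q' = p
    · rw [diffKernel, sub_eq_zero]
      refine diffKernel_congr L ?_
      ext x
      rcases hp with rfl | rfl <;> simp only [Set.mem_inter_iff] <;> tauto
    · have h' : q ∈ L ∨ q' ∈ L := by
        simp only [List.mem_cons] at h
        tauto
      rw [diffKernel, ih h', ih h', sub_zero]

theorem diffKernel_empty (L : List P) (q q' : P) : diffKernel U L ∅ q q' = 0 := by
  induction L with
  | nil => exact lcmKernel_of_empty (Set.inter_empty _)
  | cons p L ih => rw [diffKernel, Set.empty_inter, ih, sub_zero]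

variable [IsRightLCM P]

/-- Two generators of one principal ideal differ by a right-invertible `u`; left cancellation puts
the same `u` into both cofactors, where `U u * star (U u) = 1` absorbs it. -/
theorem lcmKernel_of_eq (hU : IsNicaPartial U) {c c' : P} (e : q * c = q' * c')
    (h : rightIdeal q ∩ rightIdeal q' ∩ S = rightIdeal (q * c)) :
    lcmKernel U S q q' = U c * star (U c') := by
  have hex : ∃ c : P × P, q * c.1 = q' * c.2 ∧
      rightIdeal q ∩ rightIdeal q' ∩ S = rightIdeal (q * c.1) := ⟨(c, c'), e, h⟩
  rw [lcmKernel, dif_pos hex]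
  obtain ⟨e1, h1⟩ := hex.choose_spec
  generalize hex.choose = d at e1 h1
  have h2 : rightIdeal (q * c) = rightIdeal (q * d.1) := h.symm.trans h1
  obtain ⟨u, hu⟩ := rightIdeal_subset_iff.mp h2.le
  obtain ⟨v, hv⟩ := rightIdeal_subset_iff.mp h2.ge
  simp only [mul_assoc] at hu hv
  have hu1 : d.1 * u = c := mul_left_cancel hu
  have hv1 : c * v = d.1 := mul_left_cancel hv
  have huv : u * v = 1 := mul_left_cancel (a := d.1) (by rw [← mul_assoc, hu1, hv1, mul_one])
  have hu2 : d.2 * u = c' := mul_left_cancel (a := q') (by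
    rw [← mul_assoc, ← e1, mul_assoc, hu1, e])
  rw [← hu1, ← hu2, hU.mul_star_unit _ _ huv]

theorem lcmKernel_cases (hU : IsNicaPartial U) (hS : IsConstructible S) (q q' : P) :
    (rightIdeal q ∩ rightIdeal q' ∩ S = ∅ ∧ lcmKernel U S q q' = 0) ∨
      ∃ c c', q * c = q' * c' ∧ rightIdeal q ∩ rightIdeal q' ∩ S = rightIdeal (q * c) ∧
        lcmKernel U S q q' = U c * star (U c') := by
  rcases ((isConstructible_rightIdeal q).inter (isConstructible_rightIdeal q')).inter hS with
    h | ⟨r, hr⟩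
  · exact .inl ⟨h, lcmKernel_of_empty h⟩
  · have hr' : r ∈ rightIdeal q ∩ rightIdeal q' ∩ S := hr ▸ mem_rightIdeal_self r
    obtain ⟨⟨⟨c, rfl⟩, ⟨c', hc'⟩⟩, -⟩ := hr'
    exact .inr ⟨c, c', hc'.symm, hr, lcmKernel_of_eq hU hc'.symm hr⟩

theorem star_lcmKernel (hU : IsNicaPartial U) (hS : IsConstructible S) (q q' : P) :
    star (lcmKernel U S q q') = lcmKernel U S q' q := by
  rcases lcmKernel_cases hU hS q q' with ⟨h, h0⟩ | ⟨c, c', e, h, h0⟩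
  · rw [h0, star_zero, lcmKernel_of_empty (by rwa [Set.inter_comm (rightIdeal q')])]
  · rw [h0, lcmKernel_of_eq hU e.symm (by rwa [Set.inter_comm (rightIdeal q'), ← e]), star_mul,
      star_star]

/-- The diagonal kernel acts like the indicator of `T`: after cancelling `q`, the product is
governed by the lcm of the cofactors `c` and `d`. -/
theorem lcmKernel_mul (hU : IsNicaPartial U) (hS : IsConstructible S) (hT : IsConstructible T)
    (q q' : P) : lcmKernel U T q q * lcmKernel U S q q' = lcmKernel U (S ∩ T) q q' := by
  have hset : rightIdeal q ∩ rightIdeal q' ∩ (S ∩ T) =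
      (rightIdeal q ∩ rightIdeal q ∩ T) ∩ (rightIdeal q ∩ rightIdeal q' ∩ S) := by
    ext x
    simp only [Set.mem_inter_iff]
    tauto
  rcases lcmKernel_cases hU hT q q with ⟨h, h0⟩ | ⟨c, c', e, h, h0⟩
  · rw [h0, zero_mul, lcmKernel_of_empty (by rw [hset, h, Set.empty_inter])]
  rcases lcmKernel_cases hU hS q q' with ⟨h1, h2⟩ | ⟨d, d', e1, h1, h2⟩
  · rw [h2, mul_zero, lcmKernel_of_empty (by rw [hset, h1, Set.inter_empty])]
  obtain rfl := mul_left_cancel e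
  rw [h, h1, rightIdeal_mul_inter] at hset
  rw [h0, h2]
  rcases IsRightLCM.clifford c d with h3 | ⟨t, h3⟩
  · rw [hU.mul_disjoint _ (lcmSet_eq_empty_iff.mpr h3),
      lcmKernel_of_empty (by rw [hset, h3, Set.image_empty])]
  · have ht : t ∈ rightIdeal c ∩ rightIdeal d := h3 ▸ mem_rightIdeal_self t
    obtain ⟨⟨a, rfl⟩, ⟨b, hb⟩⟩ := ht
    have hb' : c * a = d * b := hb.symm
    rw [hU.mul_lcm hb' h3]
    refine (lcmKernel_of_eq hU ?_ ?_).symm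
    · rw [hb', ← mul_assoc, e1, mul_assoc]
    · rw [hset, h3, rightIdeal_mul q]

/-- A generator `s * t` of `T` has cofactors `b * t` and `b' * t` over `q` and `q'`, so these points
enter only through the outer factors. -/
theorem lcmKernel_factor (hU : IsNicaPartial U) (hT : IsConstructible T) {s b b' : P}
    (e : s = q * b) (e' : s = q' * b') (hTs : T ⊆ rightIdeal s) :
    lcmKernel U T q q' = U b * lcmKernel U T s s * star (U b') := by
  have hq : rightIdeal s ⊆ rightIdeal q := e ▸ rightIdeal_mul_subset q b
  have hq' : rightIdeal s ⊆ rightIdeal q' := e' ▸ rightIdeal_mul_subset q' b'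
  have h1 : rightIdeal q ∩ rightIdeal q' ∩ T = T :=
    Set.inter_eq_right.mpr (Set.subset_inter (hTs.trans hq) (hTs.trans hq'))
  have h2 : rightIdeal s ∩ rightIdeal s ∩ T = T :=
    Set.inter_eq_right.mpr (Set.subset_inter hTs hTs)
  rcases hT with rfl | ⟨r, rfl⟩
  · rw [lcmKernel_of_empty h1, lcmKernel_of_empty h2, mul_zero, zero_mul]
  · obtain ⟨t, rfl⟩ := rightIdeal_subset_iff.mp hTs
    rw [lcmKernel_of_eq hU (c := t) (c' := t) rfl h2,
      lcmKernel_of_eq hU (c := b * t) (c' := b' * t)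
        (by rw [← mul_assoc, ← e, ← mul_assoc, ← e'])
        (by rw [h1, ← mul_assoc, ← e]), map_mul, map_mul, star_mul]
    simp only [mul_assoc]

theorem star_diffKernel (hU : IsNicaPartial U) (L : List P) (hS : IsConstructible S) (q q' : P) :
    star (diffKernel U L S q q') = diffKernel U L S q' q := by
  induction L generalizing S with
  | nil => exact star_lcmKernel hU hS q q'
  | cons p L ih =>
    rw [diffKernel, star_sub, ih hS, ih (hS.inter (isConstructible_rightIdeal p)), diffKernel]

theorem lcmKernel_mul_diffKernel (hU : IsNicaPartial U) (L : List P) (hS : IsConstructible S)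
    (hT : IsConstructible T) (q q' : P) :
    lcmKernel U T q q * diffKernel U L S q q' = diffKernel U L (S ∩ T) q q' := by
  induction L generalizing S with
  | nil => exact lcmKernel_mul hU hS hT q q'
  | cons p L ih =>
    rw [diffKernel, mul_sub, ih hS, ih (hS.inter (isConstructible_rightIdeal p)), diffKernel,
      Set.inter_right_comm]

theorem diffKernel_factor (hU : IsNicaPartial U) (L : List P) (hS : IsConstructible S) {s b b' : P}
    (e : s = q * b) (e' : s = q' * b') (hSs : S ⊆ rightIdeal s) :
    diffKernel U L S q q' = U b * diffKernel U L S s s * star (U b') := by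
  induction L generalizing S with
  | nil => exact lcmKernel_factor hU hS e e' hSs
  | cons p L ih =>
    rw [diffKernel, diffKernel, ih hS hSs, ih (hS.inter (isConstructible_rightIdeal p))
      (Set.inter_subset_left.trans hSs), mul_sub, sub_mul]

theorem isStarProjection_lcmKernel (hU : IsNicaPartial U) (hS : IsConstructible S) (s : P) :
    IsStarProjection (lcmKernel U S s s) :=
  ⟨by rw [IsIdempotentElem, lcmKernel_mul hU hS hS, Set.inter_self], star_lcmKernel hU hS s s⟩

theorem isStarProjection_diffKernel (hU : IsNicaPartial U) (L : List P) (hS : IsConstructible S)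
    (s : P) : IsStarProjection (diffKernel U L S s s) := by
  induction L with
  | nil => exact isStarProjection_lcmKernel hU hS s
  | cons p L ih =>
    have hp := isConstructible_rightIdeal p
    have h1 := lcmKernel_mul_diffKernel hU L hS hp s s
    have h2 : diffKernel U (p :: L) S s s =
        (1 - lcmKernel U (rightIdeal p) s s) * diffKernel U L S s s := by
      rw [sub_mul, one_mul, h1, diffKernel]
    have h3 : Commute (lcmKernel U (rightIdeal p) s s) (diffKernel U L S s s) := by
      -- Both factors and their product are self-adjoint, so the factors commute.
      have h4 := congrArg star h1
      rw [star_mul, star_lcmKernel hU hp, star_diffKernel hU L hS,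
        star_diffKernel hU L (hS.inter hp)] at h4
      exact h1.trans h4.symm
    rw [h2]
    exact (isStarProjection_lcmKernel hU hp s).one_sub.mul ih ((Commute.one_left _).sub_left h3)

end Kernel

/-! ### Positivity and left invariance of the kernel -/

section Positive

variable {P : Type*} [Monoid P] {H : Type*} [NormedAddCommGroup H]
  [InnerProductSpace ℂ H] [CompleteSpace H] {U : P →* (H →L[ℂ] H)}

/-- The reproducing kernel of the dilation of a Nica covariant family. -/
noncomputable def nicaKernel (U : P →* (H →L[ℂ] H)) : Matrix P P (H →L[ℂ] H) :=
  Matrix.of (lcmKernel U Set.univ)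

theorem nicaKernel_of_disjoint {q q' : P} (h : rightIdeal q ∩ rightIdeal q' = ∅) :
    nicaKernel U q q' = 0 :=
  lcmKernel_of_empty (by rwa [Set.inter_univ])

theorem nicaKernel_mul_of_disjoint {p q : P} (h : rightIdeal p ∩ rightIdeal q = ∅) (x : P) :
    nicaKernel U (p * x) q = 0 :=
  nicaKernel_of_disjoint (Set.subset_empty_iff.mp
    ((Set.inter_subset_inter_left _ (rightIdeal_mul_subset p x)).trans h.le))

variable [IsRightLCM P]

/-- `M` lists the undecided points. The kernel of `S` is the sum of those of `S \ pP` and `S ∩ pP`,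
so deciding one `p` at a time reaches the atoms. There each `q` is either removed or has `S ⊆ qP`,
and the form becomes `‖Q (∑ β_q* ξ_q)‖²`. -/
theorem re_sum_inner_diffKernel_nonneg (hU : IsNicaPartial U) (F : Finset P) (ξ : P → H)
    (M L : List P) {S : Set P} (hS : IsConstructible S)
    (hF : ∀ q ∈ F, q ∈ M ∨ q ∈ L ∨ S ⊆ rightIdeal q) :
    0 ≤ RCLike.re (∑ q ∈ F, ∑ q' ∈ F, inner ℂ (diffKernel U L S q' q (ξ q)) (ξ q')) := by
  classical
  induction M generalizing L S with
  | nil =>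
    rcases hS with rfl | ⟨s, rfl⟩
    · simp [diffKernel_empty]
    -- `β q` is the outer factor of `diffKernel_factor`, and `0` at removed points; outside `F` its
    -- value is irrelevant.
    have hβ : ∀ q, ∃ β : H →L[ℂ] H,
        (q ∈ L ∧ β = 0) ∨ (q ∉ L ∧ (q ∈ F → ∃ b, s = q * b ∧ β = U b)) := by
      intro q
      by_cases hq : q ∈ L
      · exact ⟨0, .inl ⟨hq, rfl⟩⟩
      · by_cases hqF : q ∈ F
        · obtain ⟨b, hb⟩ := rightIdeal_subset_iff.mp
            (((hF q hqF).resolve_left List.not_mem_nil).resolve_left hq)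
          exact ⟨U b, .inr ⟨hq, fun _ => ⟨b, hb.symm, rfl⟩⟩⟩
        · exact ⟨0, .inr ⟨hq, fun h => absurd h hqF⟩⟩
    choose β hβ using hβ
    set Q := diffKernel U L (rightIdeal s) s s with hQ
    have hQp := isStarProjection_diffKernel hU L (isConstructible_rightIdeal s) s
    rw [← hQ] at hQp
    have hN : ∀ q ∈ F, ∀ q' ∈ F, diffKernel U L (rightIdeal s) q' q = β q' * Q * star (β q) := by
      intro q hq q' hq'
      rcases hβ q with ⟨h, h0⟩ | ⟨h, h0⟩
      · rw [diffKernel_of_mem (.inr h), h0, star_zero, mul_zero]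
      rcases hβ q' with ⟨h', h0'⟩ | ⟨h', h0'⟩
      · rw [diffKernel_of_mem (.inl h'), h0', zero_mul, zero_mul]
      obtain ⟨b, hb, hb'⟩ := h0 hq
      obtain ⟨c, hc, hc'⟩ := h0' hq'
      rw [hb', hc', diffKernel_factor hU L (isConstructible_rightIdeal s) hc hb subset_rfl]
    have hsum : ∑ q ∈ F, ∑ q' ∈ F, inner ℂ (diffKernel U L (rightIdeal s) q' q (ξ q)) (ξ q') =
        inner ℂ (Q (∑ q ∈ F, star (β q) (ξ q))) (Q (∑ q ∈ F, star (β q) (ξ q))) := by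
      have h1 : ∀ x y : H, inner ℂ (Q x) (Q y) = inner ℂ (Q x) y := by
        intro x y
        have h2 : star Q = Q := hQp.isSelfAdjoint
        have h3 : Q (Q x) = Q x := DFunLike.congr_fun hQp.isIdempotentElem x
        conv_lhs => rw [← h2]
        rw [ContinuousLinearMap.star_eq_adjoint Q, ContinuousLinearMap.adjoint_inner_right,
          ← ContinuousLinearMap.star_eq_adjoint, h2, h3]
      rw [h1, map_sum, sum_inner]
      refine Finset.sum_congr rfl fun q hq => ?_
      rw [inner_sum]
      refine Finset.sum_congr rfl fun q' hq' => ?_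
      rw [hN q hq q' hq', ContinuousLinearMap.star_eq_adjoint (β q'),
        ContinuousLinearMap.adjoint_inner_right]
      rfl
    rw [hsum]
    exact inner_self_nonneg
  | cons p M ih =>
    have hp := isConstructible_rightIdeal p
    have h1 := ih (p :: L) hS fun q hq => by
      have := hF q hq
      simp only [List.mem_cons] at this ⊢
      tauto
    have h2 := ih L (hS.inter hp) fun q hq => by
      have := hF q hq
      simp only [List.mem_cons] at this
      rcases this with (rfl | h) | h | h
      · exact .inr (.inr Set.inter_subset_right)
      · exact .inl h
      · exact .inr (.inl h)
      · exact .inr (.inr (Set.inter_subset_left.trans h))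
    have h3 := add_nonneg h1 h2
    rw [← map_add] at h3
    simpa only [diffKernel, ← Finset.sum_add_distrib, ← inner_add_left,
      ← add_apply, sub_add_cancel] using h3

open scoped ComplexOrder in
theorem posSemidef_nicaKernel (hU : IsNicaPartial U) : (nicaKernel U).PosSemidef := by
  have hS : IsConstructible (Set.univ : Set P) := .inr ⟨1, rightIdeal_one.symm⟩
  have htfae := (RKHS.posSemidef_tfae (K := nicaKernel U)).out 0 2
  refine htfae.mpr ⟨?_, fun ξ => ?_⟩
  · ext1 q q'
    exact star_lcmKernel hU hS q' q
  · exact re_sum_inner_diffKernel_nonneg hU ξ.support ξ ξ.support.toList [] hS fun q hq =>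
      .inl (Finset.mem_toList.mpr hq)

theorem nicaKernel_of_eq (hU : IsNicaPartial U) {q q' c c' : P} (e : q * c = q' * c')
    (h : rightIdeal q ∩ rightIdeal q' = rightIdeal (q * c)) :
    nicaKernel U q q' = U c * star (U c') :=
  lcmKernel_of_eq hU e (by rwa [Set.inter_univ])

theorem nicaKernel_mul_mul (hU : IsNicaPartial U) (p q q' : P) :
    nicaKernel U (p * q) (p * q') = nicaKernel U q q' := by
  rcases IsRightLCM.clifford q q' with h | ⟨r, h⟩
  · rw [nicaKernel_of_disjoint h,
      nicaKernel_of_disjoint (by rw [rightIdeal_mul_inter, h, Set.image_empty])]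
  · have hr : r ∈ rightIdeal q ∩ rightIdeal q' := h ▸ mem_rightIdeal_self r
    obtain ⟨⟨c, rfl⟩, ⟨c', hc⟩⟩ := hr
    have hc' : q * c = q' * c' := hc.symm
    rw [nicaKernel_of_eq hU hc' h, nicaKernel_of_eq hU (by rw [mul_assoc, hc', mul_assoc])
      (by rw [rightIdeal_mul_inter, h, mul_assoc, rightIdeal_mul p])]

/-- In operator terms: the adjoint of translation by `p` moves the kernel function at `q` to `a` and
applies `star (U b)` to the vector. -/
theorem nicaKernel_mul_of_eq (hU : IsNicaPartial U) {p q a b : P} (e : p * a = q * b)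
    (h : rightIdeal p ∩ rightIdeal q = rightIdeal (p * a)) (x : P) :
    nicaKernel U (p * x) q = nicaKernel U x a * star (U b) := by
  have hset : rightIdeal (p * x) ∩ rightIdeal q = (p * ·) '' (rightIdeal x ∩ rightIdeal a) := by
    rw [← rightIdeal_mul_inter, ← h, ← Set.inter_assoc,
      Set.inter_eq_left.mpr (rightIdeal_mul_subset p x)]
  rcases IsRightLCM.clifford x a with h1 | ⟨r, h1⟩
  · rw [nicaKernel_of_disjoint h1, nicaKernel_of_disjoint (by rw [hset, h1, Set.image_empty]),
      zero_mul]
  · have hr : r ∈ rightIdeal x ∩ rightIdeal a := h1 ▸ mem_rightIdeal_self r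
    obtain ⟨⟨c, rfl⟩, ⟨d, hd⟩⟩ := hr
    have hd' : x * c = a * d := hd.symm
    rw [nicaKernel_of_eq hU hd' h1, nicaKernel_of_eq hU (c := c) (c' := b * d)
      (by rw [mul_assoc, hd', ← mul_assoc, e, mul_assoc])
      (by rw [hset, h1, mul_assoc, rightIdeal_mul p]), map_mul, star_mul, mul_assoc]

theorem nicaKernel_one_right (hU : IsNicaPartial U) (x : P) : nicaKernel U x 1 = star (U x) := by
  rw [nicaKernel_of_eq hU (c := 1) (c' := x) (by simp) (by simp [rightIdeal_one]), map_one,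
    one_mul]

theorem nicaKernel_self (hU : IsNicaPartial U) (x : P) : nicaKernel U x x = 1 := by
  rw [nicaKernel_of_eq hU (c := 1) (c' := 1) rfl (by simp), map_one, star_one, one_mul]

end Positive

/-! ### Translation operators on reproducing kernel Hilbert spaces -/

/-- The norm depends only on the Gram matrix; for an invariant kernel this makes translation
isometric on a dense span. -/
theorem norm_linearCombination_eq {ι H H' : Type*} [NormedAddCommGroup H] [InnerProductSpace ℂ H]
    [NormedAddCommGroup H'] [InnerProductSpace ℂ H'] {v : ι → H} {w : ι → H'}
    (h : ∀ i j, inner ℂ (v i) (v j) = inner ℂ (w i) (w j)) (f : ι →₀ ℂ) :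
    ‖Finsupp.linearCombination ℂ v f‖ = ‖Finsupp.linearCombination ℂ w f‖ := by
  have h' : inner ℂ (Finsupp.linearCombination ℂ v f) (Finsupp.linearCombination ℂ v f) =
      inner ℂ (Finsupp.linearCombination ℂ w f) (Finsupp.linearCombination ℂ w f) := by
    simp only [Finsupp.linearCombination_apply, Finsupp.sum, sum_inner, inner_sum, inner_smul_left,
      inner_smul_right, h]
  rw [inner_self_eq_norm_sq_to_K, inner_self_eq_norm_sq_to_K] at h'
  have h2 : ‖Finsupp.linearCombination ℂ v f‖ ^ 2 = ‖Finsupp.linearCombination ℂ w f‖ ^ 2 := by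
    exact_mod_cast h'
  exact (sq_eq_sq₀ (norm_nonneg _) (norm_nonneg _)).mp h2

namespace RKHS

variable {X V E : Type*} [NormedAddCommGroup V] [InnerProductSpace ℂ V] [CompleteSpace V]
  [NormedAddCommGroup E] [InnerProductSpace ℂ E] [CompleteSpace E] [RKHS ℂ E X V]

theorem clm_ext_kerFun {F : Type*} [NormedAddCommGroup F] [NormedSpace ℂ F] {S T : E →L[ℂ] F}
    (h : ∀ x v, S (kerFun E x v) = T (kerFun E x v)) : S = T := by
  refine ContinuousLinearMap.ext_on
    (Submodule.dense_iff_topologicalClosure_eq_top.mpr (kerFun_dense (H := E))) ?_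
  rintro _ ⟨x, v, rfl⟩
  exact h x v

variable (E) in
/-- Linear combinations of the kernel functions at the points `φ x`. -/
noncomputable def kerFunCombination (φ : X → X) : (X × V →₀ ℂ) →ₗ[ℂ] E :=
  Finsupp.linearCombination ℂ fun xv : X × V => kerFun E (φ xv.1) xv.2

theorem kerFunCombination_single (φ : X → X) (x : X) (v : V) :
    kerFunCombination E φ (Finsupp.single (x, v) 1) = kerFun E (φ x) v := by
  simp [kerFunCombination]

theorem denseRange_kerFunCombination : DenseRange (kerFunCombination E (id : X → X)) := by
  have h := Submodule.dense_iff_topologicalClosure_eq_top.mpr (kerFun_dense (H := E))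
  refine h.mono ?_
  rw [← LinearMap.coe_range, SetLike.coe_subset_coe, Submodule.span_le]
  rintro _ ⟨x, v, rfl⟩
  exact ⟨_, kerFunCombination_single id x v⟩

/-- The operator that sends the kernel function at `x` to the kernel function at `φ x`. -/
noncomputable def translate (φ : X → X) : E →L[ℂ] E :=
  (kerFunCombination E φ).extendOfNorm (kerFunCombination E id)

variable {φ : X → X}

theorem translate_kerFun (hφ : ∀ x y, kernel E (φ x) (φ y) = kernel E x y) (x : X) (v : V) :
    translate φ (kerFun E x v) = kerFun E (φ x) v := by
  rw [← kerFunCombination_single φ, ← LinearMap.extendOfNorm_eq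
    (denseRange_kerFunCombination (E := E)) ⟨1, fun f => ?_⟩, kerFunCombination_single]
  · rfl
  · rw [one_mul]
    refine (norm_linearCombination_eq (fun i j => ?_) f).le
    rw [← kernel_inner, ← kernel_inner, hφ]
    rfl

theorem star_translate_apply (hφ : ∀ x y, kernel E (φ x) (φ y) = kernel E x y) (f : E) (x : X) :
    star (translate φ) f x = f (φ x) := by
  refine ext_inner_left ℂ fun v => ?_
  rw [← kerFun_inner, ContinuousLinearMap.star_eq_adjoint,
    ContinuousLinearMap.adjoint_inner_right, translate_kerFun hφ, kerFun_inner]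

theorem star_translate_mul_self (hφ : ∀ x y, kernel E (φ x) (φ y) = kernel E x y) :
    star (translate φ) * translate φ = (1 : E →L[ℂ] E) := by
  refine clm_ext_kerFun fun x v => RKHS.ext fun y => ?_
  change star (translate φ) (translate φ (kerFun E x v)) y = kerFun E x v y
  rw [star_translate_apply hφ, translate_kerFun hφ, kerFun_apply, kerFun_apply, hφ]

end RKHS

/-! ### The dilation of a Nica covariant family -/

section Dilation

open RKHS

variable {P : Type*} [Monoid P] {H : Type*} [NormedAddCommGroup H]
  [InnerProductSpace ℂ H] [CompleteSpace H]
  {E : Type*} [NormedAddCommGroup E] [InnerProductSpace ℂ E] [CompleteSpace E] [RKHS ℂ E P H]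

variable (E) in
/-- The translations of a reproducing kernel Hilbert space with left invariant kernel. -/
noncomputable def translationHom (h : ∀ p q q' : P, kernel E (p * q) (p * q') = kernel E q q') :
    P →* (E →L[ℂ] E) where
  toFun p := translate (p * ·)
  map_one' := clm_ext_kerFun fun x v => by
    rw [translate_kerFun (h 1), one_mul]
    rfl
  map_mul' p q := clm_ext_kerFun fun x v => by
    change _ = translate (p * ·) (translate (q * ·) (kerFun E x v))
    rw [translate_kerFun (h _), translate_kerFun (h _), translate_kerFun (h _), mul_assoc]

theorem translationHom_kerFun (h : ∀ p q q' : P, kernel E (p * q) (p * q') = kernel E q q')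
    (p q : P) (v : H) : translationHom E h p (kerFun E q v) = kerFun E (p * q) v :=
  translate_kerFun (h p) q v

theorem star_translationHom_apply (h : ∀ p q q' : P, kernel E (p * q) (p * q') = kernel E q q')
    (p q : P) (f : E) : star (translationHom E h p) f q = f (p * q) :=
  star_translate_apply (h p) f q

variable [IsRightLCM P] {U : P →* (H →L[ℂ] H)}

theorem kernel_mul_mul (hU : IsNicaPartial U) (hE : kernel E = nicaKernel U) (p q q' : P) :
    kernel E (p * q) (p * q') = kernel E q q' := by
  rw [hE, nicaKernel_mul_mul hU]

variable (hU : IsNicaPartial U) (hE : kernel E = nicaKernel U)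

include hU hE

theorem translationHom_range_of_eq (p q b : P) (v : H)
    (h : rightIdeal q ∩ rightIdeal p = rightIdeal (q * b)) :
    (translationHom E (kernel_mul_mul hU hE) p * star (translationHom E (kernel_mul_mul hU hE) p))
      (kerFun E q v) = kerFun E (q * b) (star (U b) v) := by
  have hb : q * b ∈ rightIdeal q ∩ rightIdeal p := h ▸ mem_rightIdeal_self _
  obtain ⟨-, ⟨a, ha⟩⟩ := hb
  have ha' : p * a = q * b := ha
  have h1 : star (translationHom E (kernel_mul_mul hU hE) p) (kerFun E q v) =
      kerFun E a (star (U b) v) := by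
    refine RKHS.ext fun x => ?_
    rw [star_translationHom_apply, kerFun_apply, kerFun_apply, hE,
      nicaKernel_mul_of_eq hU ha' (by rw [Set.inter_comm, h, ha']), mul_clm_apply]
  rw [mul_clm_apply, h1, translationHom_kerFun, ha']

theorem translationHom_range_of_disjoint (p q : P) (v : H)
    (h : rightIdeal q ∩ rightIdeal p = ∅) :
    (translationHom E (kernel_mul_mul hU hE) p * star (translationHom E (kernel_mul_mul hU hE) p))
      (kerFun E q v) = 0 := by
  have h1 : star (translationHom E (kernel_mul_mul hU hE) p) (kerFun E q v) = 0 := by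
    refine RKHS.ext fun x => ?_
    rw [star_translationHom_apply, kerFun_apply, hE,
      nicaKernel_mul_of_disjoint (by rwa [Set.inter_comm]), RKHS.coe_zero]
    rfl
  rw [mul_clm_apply, h1, map_zero]

/-- On kernel functions the range projection of `p` replaces the point `q` by its lcm with `p`, so
covariance reduces to `(qP ∩ yP) ∩ xP = qP ∩ rP`. -/
theorem isNicaCovariant_translationHom :
    IsNicaCovariant (translationHom E (kernel_mul_mul hU hE)) where
  isometric p := star_translate_mul_self (kernel_mul_mul hU hE p)
  covariant x y r hr := clm_ext_kerFun fun q v => by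
    have hxy : rightIdeal x ∩ rightIdeal y = rightIdeal r := hr
    have hset : rightIdeal q ∩ rightIdeal r = rightIdeal q ∩ rightIdeal y ∩ rightIdeal x := by
      rw [← hxy, Set.inter_comm (rightIdeal x), Set.inter_assoc]
    rw [mul_clm_apply]
    rcases IsRightLCM.clifford q y with h | ⟨s, h⟩
    · rw [translationHom_range_of_disjoint hU hE y q v h, map_zero,
        translationHom_range_of_disjoint hU hE r q v (by rw [hset, h, Set.empty_inter])]
    obtain ⟨b, rfl⟩ : s ∈ rightIdeal q := Set.inter_subset_left (h ▸ mem_rightIdeal_self s)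
    rw [translationHom_range_of_eq hU hE y q b v h]
    rcases IsRightLCM.clifford (q * b) x with h' | ⟨s, h'⟩
    · rw [translationHom_range_of_disjoint hU hE x (q * b) _ h',
        translationHom_range_of_disjoint hU hE r q v (by rw [hset, h, h'])]
    obtain ⟨c, rfl⟩ : s ∈ rightIdeal (q * b) :=
      Set.inter_subset_left (h' ▸ mem_rightIdeal_self s)
    rw [translationHom_range_of_eq hU hE x (q * b) c _ h',
      translationHom_range_of_eq hU hE r q (b * c) v (by rw [hset, h, h', ← mul_assoc]), map_mul,
      star_mul, mul_assoc, mul_clm_apply]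
  orthogonal x y hxy := clm_ext_kerFun fun q v => by
    rw [lcmSet_eq_empty_iff] at hxy
    rw [mul_clm_apply]
    rcases IsRightLCM.clifford q y with h | ⟨s, h⟩
    · rw [translationHom_range_of_disjoint hU hE y q v h, map_zero]
      rfl
    obtain ⟨b, rfl⟩ : s ∈ rightIdeal q := Set.inter_subset_left (h ▸ mem_rightIdeal_self s)
    rw [translationHom_range_of_eq hU hE y q b v h,
      translationHom_range_of_disjoint hU hE x (q * b) _ ?_]
    · rfl
    · rw [← h, Set.inter_assoc, Set.inter_comm (rightIdeal y), hxy, Set.inter_empty]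

theorem norm_kerFun_apply (q : P) (v : H) : ‖kerFun E q v‖ = ‖v‖ := by
  have h : inner ℂ (kerFun E q v) (kerFun E q v) = inner ℂ v v := by
    rw [← kernel_inner, hE, nicaKernel_self hU]
    rfl
  rw [inner_self_eq_norm_sq_to_K, inner_self_eq_norm_sq_to_K] at h
  have h2 : ‖kerFun E q v‖ ^ 2 = ‖v‖ ^ 2 := by exact_mod_cast h
  exact (sq_eq_sq₀ (norm_nonneg _) (norm_nonneg _)).mp h2

theorem star_translationHom_kerFun_one (x : P) (v : H) :
    star (translationHom E (kernel_mul_mul hU hE) x) (kerFun E 1 v) =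
      kerFun E 1 (star (U x) v) := by
  refine RKHS.ext fun y => ?_
  rw [star_translationHom_apply, kerFun_apply, kerFun_apply, hE, nicaKernel_one_right hU,
    nicaKernel_one_right hU, map_mul, star_mul, mul_clm_apply]

/-- Equality in Cauchy–Schwarz: both vectors have norm `‖v‖`, and their inner product is `‖v‖²`
because `star T` returns the second one to `kerFun E 1 v`. -/
theorem translationHom_kerFun_one {x : P} (hx : star (U x) * U x = 1) (v : H) :
    translationHom E (kernel_mul_mul hU hE) x (kerFun E 1 v) = kerFun E 1 (U x v) := by
  set T := translationHom E (kernel_mul_mul hU hE) x with hT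
  have h1 : star T (kerFun E 1 (U x v)) = kerFun E 1 v := by
    rw [hT, star_translationHom_kerFun_one hU hE, ← mul_clm_apply, hx]
    rfl
  have hTi : ∀ f, ‖T f‖ = ‖f‖ := (ContinuousLinearMap.norm_map_iff_adjoint_comp_self T).mpr
    (star_translate_mul_self (kernel_mul_mul hU hE x))
  have hUi : ∀ f, ‖U x f‖ = ‖f‖ :=
    (ContinuousLinearMap.norm_map_iff_adjoint_comp_self (U x)).mpr hx
  have h2 : inner ℂ (T (kerFun E 1 v)) (kerFun E 1 (U x v)) =
      inner ℂ (kerFun E 1 v) (kerFun E 1 v) := by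
    rw [← ContinuousLinearMap.adjoint_inner_right, ← ContinuousLinearMap.star_eq_adjoint, h1]
  rw [← sub_eq_zero, ← norm_eq_zero, ← sq_eq_zero_iff, @norm_sub_sq ℂ, h2, hTi,
    norm_kerFun_apply hU hE, norm_kerFun_apply hU hE, hUi, inner_self_eq_norm_sq,
    norm_kerFun_apply hU hE]
  ring

end Dilation

/-- In general `J` intertwines only the adjoints, as `π.V x` is isometric even where `U x = 0`. -/
theorem IsNicaPartial.exists_dilation {P H : Type u} [Monoid P] [IsRightLCM P]
    [NormedAddCommGroup H] [InnerProductSpace ℂ H] [CompleteSpace H] [Nontrivial H]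
    {U : P →* (H →L[ℂ] H)} (hU : IsNicaPartial U) :
    ∃ (π : NicaRep P) (J : H →L[ℂ] π.H), (∀ v, ‖J v‖ = ‖v‖) ∧
      (∀ x v, star (π.V x) (J v) = J (star (U x) v)) ∧
      ∀ x v, star (U x) * U x = 1 → π.V x (J v) = J (U x v) := by
  have : Fact (nicaKernel U).PosSemidef := ⟨posSemidef_nicaKernel hU⟩
  have hE : RKHS.kernel (RKHS.OfKernel (nicaKernel U)) = nicaKernel U :=
    RKHS.OfKernel.kernel_ofKernel
  have hn := norm_kerFun_apply hU hE 1
  obtain ⟨v, hv⟩ := exists_ne (0 : H)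
  refine ⟨{ H := RKHS.OfKernel (nicaKernel U)
            nontrivial := ⟨RKHS.kerFun _ 1 v, 0, ?_⟩
            V := translationHom _ (kernel_mul_mul hU hE)
            nica := isNicaCovariant_translationHom hU hE }, RKHS.kerFun _ 1, hn,
    star_translationHom_kerFun_one hU hE, fun x v hx => translationHom_kerFun_one hU hE hx v⟩
  rw [← norm_ne_zero_iff, hn]
  exact norm_ne_zero_iff.mpr hv

/-! ### Submonoids closed under factorization -/

section Submonoid

variable {P : Type*} [Monoid P] {P₁ : Submonoid P}

theorem ClosedUnderFactorization.mem_of_mem_rightIdeal (hfact : ClosedUnderFactorization P₁)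
    {r z : P} (hz : z ∈ P₁) (h : z ∈ rightIdeal r) : r ∈ P₁ := by
  obtain ⟨y, rfl⟩ := h
  exact (hfact r y hz).1

theorem ClosedUnderFactorization.mem_rightIdeal_iff (hfact : ClosedUnderFactorization P₁)
    {z x : P₁} : z ∈ rightIdeal x ↔ (z : P) ∈ rightIdeal (x : P) := by
  constructor
  · rintro ⟨y, rfl⟩
    exact ⟨y, rfl⟩
  · rintro ⟨y, hy⟩
    have hy' : (x : P) * y = z := hy
    exact ⟨⟨y, (hfact x y (hy' ▸ z.2)).2⟩, Subtype.ext hy'⟩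

theorem mem_lcmSet_of_coe (hfact : ClosedUnderFactorization P₁) {x y r : P₁}
    (h : (r : P) ∈ lcmSet (x : P) y) : r ∈ lcmSet x y := by
  have h' : rightIdeal (x : P) ∩ rightIdeal (y : P) = rightIdeal (r : P) := h
  change rightIdeal x ∩ rightIdeal y = rightIdeal r
  ext z
  rw [Set.mem_inter_iff, hfact.mem_rightIdeal_iff, hfact.mem_rightIdeal_iff,
    hfact.mem_rightIdeal_iff, ← Set.mem_inter_iff, h']

/-- Orthogonality supplies a common multiple `z` in `P₁`, and `r` is a left factor of `z`. -/
theorem mem_of_mem_lcmSet (hfact : ClosedUnderFactorization P₁) (horth : PreservesOrthogonality P₁)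
    {x y : P₁} {r : P} (h : r ∈ lcmSet (x : P) y) : r ∈ P₁ := by
  have h' : rightIdeal (x : P) ∩ rightIdeal (y : P) = rightIdeal r := h
  have h0 : (rightIdeal x ∩ rightIdeal y).Nonempty := by
    rw [Set.nonempty_iff_ne_empty, Ne, horth x y, h']
    exact rightIdeal_ne_empty r
  obtain ⟨z, hz⟩ := h0
  refine hfact.mem_of_mem_rightIdeal z.2 (h' ▸ ⟨?_, ?_⟩)
  · exact hfact.mem_rightIdeal_iff.mp hz.1
  · exact hfact.mem_rightIdeal_iff.mp hz.2

theorem isRightLCM_submonoid [IsRightLCM P] (hfact : ClosedUnderFactorization P₁)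
    (horth : PreservesOrthogonality P₁) : IsRightLCM P₁ where
  mul_left_cancel a b c h := Subtype.ext (mul_left_cancel (a := (a : P)) (congrArg Subtype.val h))
  clifford x y := by
    rcases IsRightLCM.clifford (x : P) y with h | ⟨r, h⟩
    · exact .inl ((horth x y).mpr h)
    · exact .inr ⟨⟨r, mem_of_mem_lcmSet hfact horth h⟩, mem_lcmSet_of_coe hfact h⟩

/-- The common multiple `r` forces an lcm `s` in `P`; as a left factor of `r` it lies in `P₁`, where
it generates the same ideal as `r`. -/
theorem coe_mem_lcmSet [IsRightLCM P] (hfact : ClosedUnderFactorization P₁) {x y r : P₁}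
    (h : r ∈ lcmSet x y) : (r : P) ∈ lcmSet (x : P) y := by
  have h' : rightIdeal x ∩ rightIdeal y = rightIdeal r := h
  have hr : r ∈ rightIdeal x ∩ rightIdeal y := h' ▸ mem_rightIdeal_self r
  have hx := hfact.mem_rightIdeal_iff.mp hr.1
  have hy := hfact.mem_rightIdeal_iff.mp hr.2
  obtain ⟨s, hs⟩ := exists_lcm hx hy
  have hs' : rightIdeal (x : P) ∩ rightIdeal (y : P) = rightIdeal s := hs
  have hrs : (r : P) ∈ rightIdeal s := hs' ▸ ⟨hx, hy⟩
  have hss : s ∈ rightIdeal (x : P) ∩ rightIdeal (y : P) := hs' ▸ mem_rightIdeal_self s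
  lift s to P₁ using hfact.mem_of_mem_rightIdeal r.2 hrs
  have hsr : s ∈ rightIdeal r :=
    h' ▸ ⟨hfact.mem_rightIdeal_iff.mpr hss.1, hfact.mem_rightIdeal_iff.mpr hss.2⟩
  change rightIdeal (x : P) ∩ rightIdeal (y : P) = rightIdeal (r : P)
  rw [hs']
  exact (rightIdeal_subset_iff.mpr (hfact.mem_rightIdeal_iff.mp hsr)).antisymm
    (rightIdeal_subset_iff.mpr hrs)

theorem lcmSet_coe_eq_empty_iff [IsRightLCM P] (hfact : ClosedUnderFactorization P₁)
    (horth : PreservesOrthogonality P₁) {x y : P₁} :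
    lcmSet (x : P) y = ∅ ↔ lcmSet x y = ∅ := by
  have := isRightLCM_submonoid hfact horth
  rw [lcmSet_eq_empty_iff, lcmSet_eq_empty_iff, horth x y]

open scoped Classical in
/-- The extension by zero of a multiplicative map on a submonoid closed under factorization. -/
noncomputable def extendByZero {A : Type*} [Ring A] (hfact : ClosedUnderFactorization P₁)
    (W : P₁ →* A) : P →* A where
  toFun x := if h : x ∈ P₁ then W ⟨x, h⟩ else 0
  map_one' := (dif_pos P₁.one_mem).trans (map_one W)
  map_mul' x y := by
    by_cases hx : x ∈ P₁
    · by_cases hy : y ∈ P₁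
      · rw [dif_pos hx, dif_pos hy, dif_pos (mul_mem hx hy), ← map_mul]
        rfl
      · rw [dif_neg hy, dif_neg fun h => hy (hfact x y h).2, mul_zero]
    · rw [dif_neg hx, dif_neg fun h => hx (hfact x y h).1, zero_mul]

section

variable {A : Type*} [Ring A] (hfact : ClosedUnderFactorization P₁) (W : P₁ →* A)

theorem extendByZero_coe (x : P₁) : extendByZero hfact W x = W x := dif_pos x.2

theorem extendByZero_of_notMem {x : P} (hx : x ∉ P₁) : extendByZero hfact W x = 0 := dif_neg hx

end

/-- If `x` or `y` is outside `P₁`, so is every common multiple `r`, and both sides of the relation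
vanish. -/
theorem isNicaPartial_extendByZero [IsRightLCM P] {A : Type*} [Ring A] [StarRing A]
    (hfact : ClosedUnderFactorization P₁) (horth : PreservesOrthogonality P₁) {W : P₁ →* A}
    (hW : IsNicaCovariant W) : IsNicaPartial (extendByZero hfact W) where
  zero_or_isometric x := by
    by_cases hx : x ∈ P₁
    · lift x to P₁ using hx
      exact .inr (by rw [extendByZero_coe, hW.isometric])
    · exact .inl (extendByZero_of_notMem hfact W hx)
  covariant x y r h := by
    have hr : r ∈ rightIdeal x ∩ rightIdeal y :=
      (show rightIdeal x ∩ rightIdeal y = rightIdeal r from h) ▸ mem_rightIdeal_self r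
    by_cases hx : x ∈ P₁
    · by_cases hy : y ∈ P₁
      · lift x to P₁ using hx
        lift y to P₁ using hy
        lift r to P₁ using mem_of_mem_lcmSet hfact horth h
        simp only [extendByZero_coe]
        exact hW.covariant x y r (mem_lcmSet_of_coe hfact h)
      · rw [extendByZero_of_notMem hfact W hy, extendByZero_of_notMem hfact W fun h =>
          hy (hfact.mem_of_mem_rightIdeal h hr.2)]
        simp
    · rw [extendByZero_of_notMem hfact W hx, extendByZero_of_notMem hfact W fun h =>
        hx (hfact.mem_of_mem_rightIdeal h hr.1)]
      simp
  orthogonal x y h := by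
    by_cases hx : x ∈ P₁
    · by_cases hy : y ∈ P₁
      · lift x to P₁ using hx
        lift y to P₁ using hy
        simp only [extendByZero_coe]
        exact hW.orthogonal x y ((lcmSet_coe_eq_empty_iff hfact horth).mp h)
      · rw [extendByZero_of_notMem hfact W hy]
        simp
    · rw [extendByZero_of_notMem hfact W hx]
      simp

end Submonoid

/-! ### Restriction of representations -/

section Restriction

variable {P : Type u} [Monoid P] [IsRightLCM P] {P₁ : Submonoid P}
  (hfact : ClosedUnderFactorization P₁) (horth : PreservesOrthogonality P₁)

/-- The restriction of a Nica covariant representation to a submonoid. -/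
abbrev NicaRep.restrict (π : NicaRep P) : NicaRep P₁ where
  H := π.H
  V := π.V.comp P₁.subtype
  nica :=
    { isometric := fun p => π.nica.isometric p
      covariant := fun x y r h => π.nica.covariant x y r (coe_mem_lcmSet hfact h)
      orthogonal := fun x y h =>
        π.nica.orthogonal x y ((lcmSet_coe_eq_empty_iff hfact horth).mpr h) }

/-- The ⋆-homomorphism of bounded families induced by the restriction of representations. -/
def restrictFamilies : BoundedFamilies P₁ →⋆ₐ[ℂ] BoundedFamilies P where
  toFun f := ⟨fun π => f (π.restrict hfact horth), memℓp_infty ⟨‖f‖, by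
    rintro _ ⟨π, rfl⟩
    exact lp.norm_apply_le_norm ENNReal.top_ne_zero f (π.restrict hfact horth)⟩⟩
  map_one' := rfl
  map_mul' _ _ := rfl
  map_zero' := rfl
  map_add' _ _ := rfl
  commutes' _ := rfl
  map_star' _ := rfl

theorem continuous_restrictFamilies : Continuous (restrictFamilies hfact horth) :=
  AddMonoidHomClass.continuous_of_bound (restrictFamilies hfact horth) 1 fun f => by
    rw [one_mul]
    exact lp.norm_le_of_forall_le (norm_nonneg f) fun π =>
      lp.norm_apply_le_norm ENNReal.top_ne_zero f (π.restrict hfact horth)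

theorem restrictFamilies_mem {a : BoundedFamilies P₁} (ha : a ∈ fullCStar P₁) :
    restrictFamilies hfact horth a ∈ fullCStar P := by
  refine map_mem_closure (continuous_restrictFamilies hfact horth) ha fun b hb => ?_
  have hle : StarAlgebra.adjoin ℂ (Set.range (universalRep P₁)) ≤
      (StarAlgebra.adjoin ℂ (Set.range (universalRep P))).comap (restrictFamilies hfact horth) := by
    refine StarAlgebra.adjoin_le ?_
    rintro _ ⟨p, rfl⟩
    exact StarAlgebra.subset_adjoin ℂ _ ⟨p, rfl⟩
  exact hle hb

end Restriction

theorem evalRep_intertwine {M : Type u} [Monoid M] (σ τ : NicaRep M) (J : σ.H →L[ℂ] τ.H)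
    (h : ∀ p v, τ.V p (J v) = J (σ.V p v)) (h' : ∀ p v, star (τ.V p) (J v) = J (star (σ.V p) v))
    {a : BoundedFamilies M} (ha : a ∈ fullCStar M) (v : σ.H) :
    evalRep M τ a (J v) = J (evalRep M σ a v) := by
  -- `J` need not be onto, so intertwining does not pass to adjoints by itself; the induction
  -- carries `a` and `star a` together.
  have hadj : ∀ a ∈ StarAlgebra.adjoin ℂ (Set.range (universalRep M)),
      (∀ v, evalRep M τ a (J v) = J (evalRep M σ a v)) ∧
        ∀ v, evalRep M τ (star a) (J v) = J (evalRep M σ (star a) v) := by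
    intro a ha
    induction ha using StarAlgebra.adjoin_induction with
    | mem x hx =>
      obtain ⟨p, rfl⟩ := hx
      exact ⟨h p, fun v => by rw [map_star, map_star]; exact h' p v⟩
    | algebraMap r =>
      refine ⟨fun v => ?_, fun v => ?_⟩
      · simp [Algebra.algebraMap_eq_smul_one]
      · rw [← algebraMap_star_comm]
        simp [Algebra.algebraMap_eq_smul_one]
    | add x y _ _ hx hy =>
      refine ⟨fun v => ?_, fun v => ?_⟩
      · simp [hx.1, hy.1]
      · simp only [star_add, map_add, add_apply, hx.2, hy.2]
    | mul x y _ _ hx hy =>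
      refine ⟨fun v => ?_, fun v => ?_⟩
      · rw [map_mul, map_mul, mul_clm_apply, mul_clm_apply, hy.1, hx.1]
      · rw [star_mul, map_mul, map_mul, mul_clm_apply, mul_clm_apply, hx.2, hy.2]
    | star x _ hx => exact ⟨hx.2, by simpa only [star_star] using hx.1⟩
  have hclosed : IsClosed {a : BoundedFamilies M | evalRep M τ a (J v) = J (evalRep M σ a v)} :=
    isClosed_eq ((continuous_evalRep M τ).clm_apply continuous_const)
      (J.continuous.comp ((continuous_evalRep M σ).clm_apply continuous_const))
  exact closure_minimal (fun a ha => (hadj a ha).1 v) hclosed ha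

/-! ### The span of the products `V p * star (V q)` -/

section Span

variable {M : Type*} [Monoid M] {A : Type*} [Ring A] [StarRing A]
  {V : M →* A}

theorem IsNicaCovariant.star_mul_of_eq (hV : IsNicaCovariant V) {q r a b : M} (e : q * a = r * b)
    (h : q * a ∈ lcmSet q r) : star (V q) * V r = V a * star (V b) := by
  have h1 : star (V q) * V r = star (V q) * (V q * star (V q) * (V r * star (V r))) * V r := by
    simp only [mul_assoc]
    rw [hV.isometric, mul_one, ← mul_assoc (star (V q)) (V q), hV.isometric, one_mul]
  rw [h1, hV.covariant q r _ h]
  nth_rw 2 [e]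
  rw [map_mul, map_mul, star_mul]
  simp only [mul_assoc]
  rw [hV.isometric, mul_one, ← mul_assoc, hV.isometric, one_mul]

theorem IsNicaCovariant.star_mul_of_disjoint (hV : IsNicaCovariant V) {q r : M}
    (h : lcmSet q r = ∅) : star (V q) * V r = 0 := by
  have h1 : star (V q) * V r = star (V q) * (V q * star (V q) * (V r * star (V r))) * V r := by
    simp only [mul_assoc]
    rw [hV.isometric, mul_one, ← mul_assoc (star (V q)) (V q), hV.isometric, one_mul]
  rw [h1, hV.orthogonal q r h, mul_zero, zero_mul]

/-- Covariance collapses an inner `star (V q) * V r` to `V a * star (V b)` or `0`, so the span is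
closed under products. -/
theorem IsNicaCovariant.adjoin_le_span [IsRightLCM M] [Algebra ℂ A] [StarModule ℂ A]
    (hV : IsNicaCovariant V) {a : A} (ha : a ∈ StarAlgebra.adjoin ℂ (Set.range V)) :
    a ∈ Submodule.span ℂ (Set.range fun x : M × M => V x.1 * star (V x.2)) := by
  set N := Submodule.span ℂ (Set.range fun x : M × M => V x.1 * star (V x.2)) with hN
  have hgen : ∀ p q, V p * star (V q) ∈ N := fun p q => Submodule.subset_span ⟨(p, q), rfl⟩
  have hmul : ∀ x ∈ N, ∀ y ∈ N, x * y ∈ N := by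
    intro x hx y hy
    induction hx, hy using Submodule.span_induction₂ with
    | mem_mem x y hx hy =>
      obtain ⟨⟨p, q⟩, rfl⟩ := hx
      obtain ⟨⟨r, s⟩, rfl⟩ := hy
      have h1 : V p * star (V q) * (V r * star (V s)) =
          V p * (star (V q) * V r) * star (V s) := by simp only [mul_assoc]
      change V p * star (V q) * (V r * star (V s)) ∈ N
      rw [h1]
      rcases IsRightLCM.clifford q r with h | ⟨t, h⟩
      · rw [hV.star_mul_of_disjoint (lcmSet_eq_empty_iff.mpr h), mul_zero, zero_mul]
        exact N.zero_mem
      · have ht : t ∈ rightIdeal q ∩ rightIdeal r := h ▸ mem_rightIdeal_self t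
        obtain ⟨⟨a, rfl⟩, ⟨b, hb⟩⟩ := ht
        have hb' : q * a = r * b := hb.symm
        have h2 : V p * (V a * star (V b)) * star (V s) = V (p * a) * star (V (s * b)) := by
          rw [map_mul, map_mul, star_mul]
          simp only [mul_assoc]
        rw [hV.star_mul_of_eq hb' h, h2]
        exact hgen _ _
    | zero_left y _ => rw [zero_mul]; exact N.zero_mem
    | zero_right x _ => rw [mul_zero]; exact N.zero_mem
    | add_left x y z _ _ _ h1 h2 => rw [add_mul]; exact N.add_mem h1 h2
    | add_right x y z _ _ _ h1 h2 => rw [mul_add]; exact N.add_mem h1 h2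
    | smul_left r x y _ _ h => rw [smul_mul_assoc]; exact N.smul_mem r h
    | smul_right r x y _ _ h => rw [mul_smul_comm]; exact N.smul_mem r h
  induction ha using StarAlgebra.adjoin_induction with
  | mem x hx =>
    obtain ⟨p, rfl⟩ := hx
    simpa using hgen p 1
  | algebraMap r =>
    rw [Algebra.algebraMap_eq_smul_one]
    exact N.smul_mem r (by simpa using hgen 1 1)
  | add x y _ _ hx hy => exact N.add_mem hx hy
  | mul x y _ _ hx hy => exact hmul x hx y hy
  | star x hx₀ hx =>
    clear hx₀
    induction hx using Submodule.span_induction with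
    | mem x hx =>
      obtain ⟨⟨p, q⟩, rfl⟩ := hx
      simpa using hgen q p
    | zero => simp
    | add x y _ _ hx hy => rw [star_add]; exact N.add_mem hx hy
    | smul r x _ hx => rw [star_smul]; exact N.smul_mem _ hx

end Span

/-! ### Vector states of the regular representation -/

theorem star_regular_mul_basis (M : Type u) [Monoid M] [IsLeftCancelMul M] (q y : M) :
    star (regularMonoidHom M q) (stdBasis M (q * y)) = stdBasis M y := by
  rw [← regular_basis, ← mul_clm_apply, regular_isometric]
  rfl

-- Right cancellation enters here: `p * y = q * y` forces `p = q`.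
open scoped Classical in
theorem inner_regular_basis {M : Type u} [Monoid M] [IsCancelMul M] (p q x : M) :
    inner ℂ (stdBasis M x)
      ((regularMonoidHom M p * star (regularMonoidHom M q)) (stdBasis M x)) =
      if p = q ∧ x ∈ rightIdeal q then (1 : ℂ) else 0 := by
  rw [mul_clm_apply]
  by_cases hx : x ∈ rightIdeal q
  · obtain ⟨y, rfl⟩ := hx
    have hq : q * y ∈ rightIdeal q := ⟨y, rfl⟩
    change inner ℂ (stdBasis M (q * y)) (regularMonoidHom M p
      (star (regularMonoidHom M q) (stdBasis M (q * y)))) =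
      if p = q ∧ q * y ∈ rightIdeal q then (1 : ℂ) else 0
    rw [star_regular_mul_basis, regular_basis, orthonormal_iff_ite.mp (stdBasis M).orthonormal]
    simp [hq, eq_comm]
  · rw [star_regular_of_notMem M hx, map_zero, inner_zero_right, if_neg fun h => hx h.2]

section VectorStates

/-- The functional on bounded families defined by a vector of a representation. -/
noncomputable def vectorState {M : Type u} [Monoid M] (π : NicaRep M) (ξ : π.H) :
    BoundedFamilies M →ₗ[ℂ] ℂ where
  toFun b := inner ℂ ξ (evalRep M π b ξ)
  map_add' b c := by rw [map_add, add_apply, inner_add_right]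
  map_smul' c b := by
    rw [map_smul, smul_apply, inner_smul_right]
    rfl

theorem continuous_vectorState {M : Type u} [Monoid M] (π : NicaRep M) (ξ : π.H) :
    Continuous (vectorState π ξ) :=
  continuous_const.inner ((continuous_evalRep M π).clm_apply continuous_const)

theorem norm_vectorState_apply_le {M : Type u} [Monoid M] (π : NicaRep M) {ξ : π.H}
    (hξ : ‖ξ‖ = 1) (b : BoundedFamilies M) : ‖vectorState π ξ b‖ ≤ ‖evalRep M π b‖ := by
  refine (norm_inner_le_norm ξ (evalRep M π b ξ)).trans ?_
  simpa [hξ] using (evalRep M π b).le_opNorm ξ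


variable {P : Type u} [Monoid P] [IsRightLCM P] [IsCancelMul P] {P₁ : Submonoid P} [IsRightLCM P₁]
  (hfact : ClosedUnderFactorization P₁) (horth : PreservesOrthogonality P₁)

/-- The left factors `z ∈ P₁` of `x` are directed, since the lcm of two of them is again one. Asking
for equality at all of them beyond `z₀` makes the claim stable under sums. -/
theorem exists_vectorState_eq (x : P) {b : BoundedFamilies P₁}
    (hb : b ∈ StarAlgebra.adjoin ℂ (Set.range (universalRep P₁))) :
    ∃ z₀ : P₁, x ∈ rightIdeal (z₀ : P) ∧ ∀ z ∈ rightIdeal z₀, x ∈ rightIdeal (z : P) →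
      vectorState ((regularRep P).restrict hfact horth) (stdBasis P x) b =
        vectorState (regularRep P₁) (stdBasis P₁ z) b := by
  classical
  have hone : x ∈ rightIdeal ((1 : P₁) : P) := ⟨x, one_mul x⟩
  have hb' := (universalRep_isNicaCovariant P₁).adjoin_le_span hb
  clear hb
  induction hb' using Submodule.span_induction with
  | mem b hb =>
    obtain ⟨⟨p, q⟩, rfl⟩ := hb
    have key : ∀ z : P₁, (x ∈ rightIdeal (q : P) ↔ z ∈ rightIdeal q) →
        inner ℂ (stdBasis P x) ((regularMonoidHom P p * star (regularMonoidHom P q))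
          (stdBasis P x)) =
        inner ℂ (stdBasis P₁ z) ((regularMonoidHom P₁ p * star (regularMonoidHom P₁ q))
          (stdBasis P₁ z)) := by
      intro z hz
      rw [inner_regular_basis, inner_regular_basis]
      simp only [Subtype.ext_iff, hz]
    by_cases hx : x ∈ rightIdeal (q : P)
    · exact ⟨q, hx, fun z hz _ => key z (iff_of_true hx hz)⟩
    · refine ⟨1, hone, fun z _ hz => key z (iff_of_false hx fun h => hx ?_)⟩
      exact rightIdeal_subset_iff.mpr (hfact.mem_rightIdeal_iff.mp h) hz
  | zero => exact ⟨1, hone, fun z _ _ => by rw [map_zero, map_zero]⟩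
  | add b c _ _ hb hc =>
    obtain ⟨z₁, h1, h1'⟩ := hb
    obtain ⟨z₂, h2, h2'⟩ := hc
    obtain ⟨r, hr⟩ := exists_lcm h1 h2
    have hr0 : r ∈ P₁ := mem_of_mem_lcmSet hfact horth hr
    lift r to P₁ using hr0
    have hr' : rightIdeal (z₁ : P) ∩ rightIdeal (z₂ : P) = rightIdeal (r : P) := hr
    have hr'' : rightIdeal z₁ ∩ rightIdeal z₂ = rightIdeal r := mem_lcmSet_of_coe hfact hr
    refine ⟨r, hr' ▸ ⟨h1, h2⟩, fun z hz hxz => ?_⟩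
    rw [← hr''] at hz
    rw [map_add, map_add, h1' z hz.1 hxz, h2' z hz.2 hxz]
  | smul c b _ hb =>
    obtain ⟨z₁, h1, h1'⟩ := hb
    refine ⟨z₁, h1, fun z hz hxz => ?_⟩
    rw [map_smul, map_smul, h1' z hz hxz]

/-- The point `z` depends on `b`, but the resulting norm bound does not mention it and so survives
the closure. -/
theorem norm_vectorState_restrict_le (x : P) {b : BoundedFamilies P₁} (hb : b ∈ fullCStar P₁) :
    ‖vectorState ((regularRep P).restrict hfact horth) (stdBasis P x) b‖ ≤
      ‖evalRep P₁ (regularRep P₁) b‖ := by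
  have hclosed : IsClosed {b : BoundedFamilies P₁ |
      ‖vectorState ((regularRep P).restrict hfact horth) (stdBasis P x) b‖ ≤
        ‖evalRep P₁ (regularRep P₁) b‖} :=
    isClosed_le (continuous_vectorState _ _).norm (continuous_evalRep P₁ (regularRep P₁)).norm
  refine closure_minimal (fun b hb => ?_) hclosed hb
  obtain ⟨z, hxz, hz⟩ := exists_vectorState_eq hfact horth x hb
  rw [Set.mem_ofPred_eq, hz z (mem_rightIdeal_self z) hxz]
  exact norm_vectorState_apply_le (regularRep P₁) ((stdBasis P₁).orthonormal.1 z) b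

theorem evalRep_restrict_regularRep_eq_zero {a : BoundedFamilies P₁} (ha : a ∈ fullCStar P₁)
    (h : evalRep P₁ (regularRep P₁) a = 0) :
    evalRep P₁ ((regularRep P).restrict hfact horth) a = 0 := by
  set T : ell2 P →L[ℂ] ell2 P := evalRep P₁ ((regularRep P).restrict hfact horth) a with hT
  refine ext_stdBasis (S := T) (T := 0) fun x => ?_
  -- On `star a * a` the vector state is `‖T δ_x‖²`.
  have h1 := norm_vectorState_restrict_le hfact horth x (mul_mem (star_mem ha) ha)
  rw [map_mul (evalRep P₁ (regularRep P₁)), h, mul_zero, norm_zero, norm_le_zero_iff] at h1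
  have h2 : inner ℂ (stdBasis P x) ((star T * T) (stdBasis P x)) = (0 : ℂ) := h1
  rw [mul_clm_apply, ContinuousLinearMap.star_eq_adjoint,
    ContinuousLinearMap.adjoint_inner_right] at h2
  exact inner_self_eq_zero.mp h2

end VectorStates

/-! ### Nica amenability -/

theorem isClosed_range_of_injective {A B : Type*} [CStarAlgebra A] [CStarAlgebra B]
    (S : StarSubalgebra ℂ A) (hS : IsClosed (S : Set A)) (f : S →⋆ₐ[ℂ] B)
    (hf : Function.Injective f) : IsClosed (Set.range f) := by
  have : CompleteSpace S := hS.completeSpace_coe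
  let _ : CStarAlgebra S := {}
  exact (NonUnitalStarAlgHom.isometry f hf).isClosedEmbedding.isClosed_range

theorem NicaRep.hom_surjective_of_injective {M : Type u} [Monoid M] (π : NicaRep M)
    (h : Function.Injective π.hom) : Function.Surjective π.hom := by
  let _ : CStarAlgebra (BoundedFamilies M) := {}
  set f : fullCStar M →⋆ₐ[ℂ] (π.H →L[ℂ] π.H) := π.cstar.subtype.comp π.hom with hf
  have hclosed : IsClosed (Set.range f) :=
    isClosed_range_of_injective (fullCStar M) (StarSubalgebra.isClosed_topologicalClosure _) f
      (Subtype.val_injective.comp h)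
  have hle : π.cstar ≤ f.range := by
    refine StarSubalgebra.topologicalClosure_minimal ?_ hclosed
    refine StarAlgebra.adjoin_le ?_
    rintro _ ⟨p, rfl⟩
    exact ⟨⟨universalRep M p, universalRep_mem p⟩, rfl⟩
  intro b
  obtain ⟨a, ha⟩ := hle b.2
  exact ⟨a, Subtype.ext ha⟩

theorem theorem3p8 (P : Type u) [Monoid P] [IsRightLCM P] [IsCancelMul P]
    (P₁ : Submonoid P) (hfact : ClosedUnderFactorization P₁)
    (horth : PreservesOrthogonality P₁) (hP : NicaAmenable P) :
    ∃ _ : IsRightLCM P₁, NicaAmenable P₁ := by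
  have hP₁ := isRightLCM_submonoid hfact horth
  have hinj : Function.Injective (regularRep P₁).hom := by
    refine (injective_iff_map_eq_zero _).mpr fun a ha => Subtype.ext ?_
    have h1 : evalRep P₁ (regularRep P₁) a = 0 := congrArg Subtype.val ha
    have h2 := evalRep_restrict_regularRep_eq_zero hfact horth a.2 h1
    -- Evaluating the restricted family at `λ_P` is evaluating `a` at the restriction of `λ_P`.
    have h3 : (⟨restrictFamilies hfact horth a, restrictFamilies_mem hfact horth a.2⟩ :
        fullCStar P) = 0 := hP.1 (Subtype.ext h2)
    have h4 : restrictFamilies hfact horth a = 0 := congrArg Subtype.val h3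
    refine lp.ext (funext fun σ => ?_)
    have hU := isNicaPartial_extendByZero hfact horth σ.nica
    obtain ⟨π, J, hJ, hstar, hV⟩ := hU.exists_dilation
    refine ContinuousLinearMap.ext fun v => ?_
    have h5 : evalRep P₁ (π.restrict hfact horth) a = 0 :=
      congrArg (fun f : BoundedFamilies P => f π) h4
    have h6 := evalRep_intertwine σ (π.restrict hfact horth) J
      (fun p v => by
        -- On `P₁` the extension by zero takes isometric values, so `J` intertwines the operators as
        -- well as their adjoints.
        have h := hV p v (by rw [extendByZero_coe, σ.nica.isometric])
        rwa [extendByZero_coe] at h)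
      (fun p v => by
        have h := hstar p v
        rwa [extendByZero_coe] at h) a.2 v
    rw [h5] at h6
    have h7 : J (evalRep P₁ σ a v) = 0 := h6.symm
    have h8 := hJ (evalRep P₁ σ a v)
    rw [h7, norm_zero] at h8
    exact norm_eq_zero.mp h8.symm
  exact ⟨hP₁, hinj, NicaRep.hom_surjective_of_injective _ hinj⟩
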